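/- Let $d,N\ge 1$ be integers. Let $P$ and $a_1,\dots,a_d$ be complex-valued holomorphic functions near $\mathbf 0\in\mathbb C^d$ with $P(\mathbf 0)=0$, let $L=a_1(\mathbf x)\partial_{x_1}+\cdots+a_d(\mathbf x)\partial_{x_d}$, and let $F$ be a $\mathbb C^N$-valued holomorphic map defined near $(\mathbf 0,\mathbf 0)\in\mathbb C^d\times\mathbb C^N$ with $F(\mathbf 0,\mathbf 0)=\mathbf 0$. Put $\mu=\frac{\partial F}{\partial \mathbf y}(\mathbf 0,\mathbf 0)\in\mathbb C^{N\times N}$. Assume that $L(P)(\mathbf 0)\neq 0$ and that the matrix $\mu-n\,L(P)(\mathbf 0)\,I_N$ is invertible for every integer $n\ge 0$ (in particular, for $n=0$, $\mu$ is invertible). Then the system of partial differential equations $$P(\mathbf x)\,L(\mathbf y)(\mathbf x)=F(\mathbf x,\mathbf y(\mathbf x))$$ has a solution $\mathbf y\in\mathbb C\{\mathbf x\}^N$ with $\mathbf y(\mathbf 0)=\mathbf 0$, that is, a $\mathbb C^N$-valued map given near the origin by convergent power series, vanishing at the origin and satisfying the equation on a neighbourhood of the origin. This solution is unique: any two such solutions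 coincide near the origin, i.e. have the same power series. -/

import Mathlib

open Filter Topology

/-- The first order differential operator `L = a₁(x) ∂_{x₁} + ⋯ + a_d(x) ∂_{x_d}` on `ℂ^d`, applied
to a scalar or vector valued function `f`. -/
noncomputable def diffOp {d : ℕ} {E : Type*} [NormedAddCommGroup E] [NormedSpace ℂ E]
    (a : Fin d → (Fin d → ℂ) → ℂ) (f : (Fin d → ℂ) → E) (x : Fin d → ℂ) : E :=
  ∑ j, a j x • fderiv ℂ f x (Pi.single j 1)

/-- The `N × N` matrix `∂F/∂y (0, 0)`, whose `(i, k)` entry is `∂F_i/∂y_k (0, 0)`. -/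
noncomputable def jacobianAtZero {d N : ℕ} (F : (Fin d → ℂ) → (Fin N → ℂ) → (Fin N → ℂ)) :
    Matrix (Fin N) (Fin N) ℂ :=
  Matrix.of fun i k => fderiv ℂ (F 0) 0 (Pi.single k 1) i

/-- `y` represents an analytic solution at the origin of the system `P · L(y) = F(x, y)`:
it is the sum of a convergent power series at the origin, it vanishes at the origin (so that the
germ at `(0, 0)` of `F` can be composed with `x ↦ (x, y x)`), and the equation holds on a
neighbourhood of the origin. -/
def IsAnalyticSolution {d N : ℕ} (P : (Fin d → ℂ) → ℂ) (a : Fin d → (Fin d → ℂ) → ℂ)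
    (F : (Fin d → ℂ) → (Fin N → ℂ) → (Fin N → ℂ)) (y : (Fin d → ℂ) → (Fin N → ℂ)) : Prop :=
  AnalyticAt ℂ y 0 ∧ y 0 = 0 ∧ ∀ᶠ x in 𝓝 (0 : Fin d → ℂ), P x • diffOp a y x = F x (y x)

/-!
Dividing by `L(P)` turns the system into `V(y) = G(x, y)`, where `V = P · b`, the vector field
`b = a / L(P)` satisfies `b(P) = 1`, and `G = F / L(P)` is split as `A y + R(x, y)` with
`A = μ / L(P)(0)` and `∂R/∂y (0, 0) = 0`. The hypothesis says that no `n ∈ ℕ` is an eigenvalue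
of `A`.

The system is solved along the integral curves of `V`, parametrised by `t = e^τ`, which are
analytic at `t = 0`, that is, on the hypersurface `P = 0`. The curve through `x` and the values `Y`
of the solution along it are sought in the Wiener algebra of absolutely convergent power series on
the unit disc, as the solutions of
`ξ' = P(x) b(ξ)`, `ξ(1) = x`, `t Y' = A Y + R(ξ, Y)` (`IsCharacteristic`).
The operator `t d/dt - A` is inverted coefficientwise by the matrices `(n - A)⁻¹`, which are bounded
(`wiener.exists_euler_inverse`), so the system is a fixed point equation `z = Ψ(x, z)` in a Banach
space. An analytic function acts analytically on tuples of small elements of a commutative Banach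
algebra (`AnalyticAt.exists_liftAlgebra`); hence `Ψ` is analytic, and since `∂Ψ/∂z (0, 0)` has
square zero, the analytic implicit function theorem yields a solution `(ξ, Y)` which depends
analytically on `x` and is unique among small ones (`exists_analyticAt_characteristic`). No loss of
derivatives occurs, and `P` and `b` need not be straightened.

The solution of the system of partial differential equations is `y(x) = Y(1)`. Indeed `P` grows at
unit rate along `b`, so `P(ξ(s)) = s P(x)`, and therefore the dilation `t ↦ (ξ(st), Y(st))` is the
characteristic through `ξ(s)`; uniqueness gives `y(ξ(s)) = Y(s)`. Differentiating in `s` gives the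
equation at `ξ(s)` for `0 < s < 1`, and `s → 1` gives it at `x`. Conversely, for any analytic
solution `y'` the pair `(ξ, y' ∘ ξ)` is a small characteristic through `x`, so `y' ∘ ξ = Y`, and at
`t = 1` this reads `y'(x) = y(x)`.
-/

open scoped ENNReal ContDiff

/-! ### The Wiener algebra -/

/-- The Wiener algebra of absolutely summable power series `∑ cₙ sⁿ`, as a subalgebra of the
formal power series over `ℂ`. -/
def wiener : Subalgebra ℂ (PowerSeries ℂ) where
  carrier := {f | Summable fun n => ‖PowerSeries.coeff n f‖}
  mul_mem' {f g} hf hg := by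
    have := summable_norm_sum_mul_antidiagonal_of_summable_norm hf hg
    simpa only [Set.mem_ofPred_eq, PowerSeries.coeff_mul] using this
  add_mem' {f g} hf hg := by
    refine Summable.of_nonneg_of_le (fun _ => norm_nonneg _) (fun n => ?_) (hf.add hg)
    simpa using norm_add_le _ _
  algebraMap_mem' r := by
    refine summable_of_ne_finset_zero (s := {0}) fun n hn => ?_
    have : n ≠ 0 := by simpa using hn
    simp [PowerSeries.coeff_C, this]

namespace wiener

/-- The `n`-th coefficient of an element of the Wiener algebra, as a linear form. -/
noncomputable def coeff (n : ℕ) : wiener →ₗ[ℂ] ℂ :=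
  (PowerSeries.coeff n).comp wiener.val.toLinearMap

theorem summable_norm (f : wiener) : Summable fun n => ‖coeff n f‖ := f.2

@[ext]
theorem ext {f g : wiener} (h : ∀ n, coeff n f = coeff n g) : f = g :=
  Subtype.ext (PowerSeries.ext h)

/-- The element of the Wiener algebra with a given summable sequence of coefficients. -/
noncomputable def ofCoeff (c : ℕ → ℂ) (hc : Summable fun n => ‖c n‖) : wiener :=
  ⟨PowerSeries.mk c, by simpa [wiener] using hc⟩

@[simp]
theorem coeff_ofCoeff (c : ℕ → ℂ) (hc : Summable fun n => ‖c n‖) (n : ℕ) :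
    coeff n (ofCoeff c hc) = c n :=
  PowerSeries.coeff_mk n c

theorem coeff_mul (n : ℕ) (f g : wiener) :
    coeff n (f * g) = ∑ p ∈ Finset.HasAntidiagonal.antidiagonal n, coeff p.1 f * coeff p.2 g :=
  PowerSeries.coeff_mul n f.1 g.1

theorem coeff_one (n : ℕ) : coeff n 1 = if n = 0 then 1 else 0 :=
  PowerSeries.coeff_one n

theorem coeff_algebraMap (n : ℕ) (r : ℂ) :
    coeff n (algebraMap ℂ wiener r) = if n = 0 then r else 0 := by
  rw [Algebra.algebraMap_eq_smul_one, map_smul, coeff_one]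
  simp

/-- The norm `∑ |cₙ|` of the Wiener algebra. -/
noncomputable def ringNorm : RingNorm wiener where
  toFun f := ∑' n, ‖coeff n f‖
  map_zero' := by simp
  add_le' f g := by
    rw [← (summable_norm f).tsum_add (summable_norm g)]
    refine (summable_norm (f + g)).tsum_le_tsum (fun n => ?_)
      ((summable_norm f).add (summable_norm g))
    rw [map_add]
    exact norm_add_le _ _
  neg' f := by simp
  mul_le' f g := by
    have hf := (summable_norm f).norm
    have hg := (summable_norm g).norm
    rw [tsum_mul_tsum_eq_tsum_sum_antidiagonal_of_summable_norm hf hg]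
    refine (summable_norm (f * g)).tsum_le_tsum (fun n => ?_)
      (summable_norm_sum_mul_antidiagonal_of_summable_norm hf hg).of_norm
    rw [coeff_mul]
    exact (norm_sum_le _ _).trans_eq (by simp)
  eq_zero_of_map_eq_zero' f hf := by
    ext n
    have := (hasSum_zero_iff_of_nonneg (fun n => norm_nonneg (coeff n f))).1
      (hf ▸ (summable_norm f).hasSum)
    simpa using congrFun this n

noncomputable instance : NormedCommRing wiener :=
  { RingNorm.toNormedRing ringNorm, (inferInstance : CommRing wiener) with }

theorem norm_def (f : wiener) : ‖f‖ = ∑' n, ‖coeff n f‖ := rfl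

theorem hasSum_norm (f : wiener) : HasSum (fun n => ‖coeff n f‖) ‖f‖ :=
  (summable_norm f).hasSum

noncomputable instance : NormedAlgebra ℂ wiener where
  __ := (inferInstance : Algebra ℂ wiener)
  norm_smul_le r f := by
    simp [norm_def, tsum_mul_left]

instance : NormOneClass wiener where
  norm_one := by
    rw [norm_def, tsum_eq_single 0]
    · simp [coeff_one]
    · intro n hn
      simp [coeff_one, hn]

theorem norm_coeff_le (n : ℕ) (f : wiener) : ‖coeff n f‖ ≤ ‖f‖ :=
  le_hasSum (hasSum_norm f) n fun _ _ => norm_nonneg _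

instance : CompleteSpace wiener := by
  let e : wiener → lp (fun _ : ℕ => ℂ) 1 := fun f =>
    ⟨fun n => coeff n f, memℓp_gen (by simpa using summable_norm f)⟩
  have he : Isometry e := by
    refine Isometry.of_dist_eq fun f g => ?_
    rw [dist_eq_norm, dist_eq_norm, lp.norm_eq_tsum_rpow (by simp), norm_def]
    simp only [ENNReal.toReal_one, Real.rpow_one, div_one, map_sub]
    rfl
  have hs : Function.Surjective e := by
    intro v
    refine ⟨ofCoeff (fun n => v n) (by simpa using (lp.memℓp v).summable (by simp)), ?_⟩
    ext n
    simp [e]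
  exact (he.isUniformInducing.completeSpace_congr hs).2 inferInstance

/-- Multiplication of the coefficients by a bounded sequence. -/
noncomputable def multiplier (m : ℕ → ℂ) (C : ℝ) (hm : ∀ n, ‖m n‖ ≤ C) : wiener →L[ℂ] wiener :=
  LinearMap.mkContinuous
    { toFun f := ofCoeff (fun n => m n * coeff n f) (by
        refine Summable.of_nonneg_of_le (fun _ => norm_nonneg _) (fun n => ?_)
          ((summable_norm f).mul_left C)
        rw [norm_mul]
        gcongr
        exact hm n)
      map_add' f g := by ext n; simp only [coeff_ofCoeff, map_add, mul_add]
      map_smul' r f := by 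
        ext n
        simp only [coeff_ofCoeff, map_smul, smul_eq_mul, mul_left_comm, RingHom.id_apply] }
    C fun f => by
    rw [norm_def, norm_def, ← tsum_mul_left]
    refine Summable.tsum_le_tsum (fun n => ?_) (summable_norm _) ((summable_norm f).mul_left C)
    simp only [LinearMap.coe_mk, AddHom.coe_mk, coeff_ofCoeff, norm_mul]
    gcongr
    exact hm n

@[simp]
theorem coeff_multiplier (m : ℕ → ℂ) (C : ℝ) (hm : ∀ n, ‖m n‖ ≤ C) (n : ℕ) (f : wiener) :
    coeff n (multiplier m C hm f) = m n * coeff n f := by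
  simp only [multiplier, LinearMap.mkContinuous_apply, LinearMap.coe_mk, AddHom.coe_mk,
    coeff_ofCoeff]

theorem norm_multiplier_apply_le (m : ℕ → ℂ) (C : ℝ) (hm : ∀ n, ‖m n‖ ≤ C) (hC : 0 ≤ C)
    (f : wiener) : ‖multiplier m C hm f‖ ≤ C * ‖f‖ :=
  (multiplier m C hm).le_of_opNorm_le (LinearMap.mkContinuous_norm_le _ hC _) f

/-- The sum of the power series at a complex number; meaningful on the closed unit disc. -/
noncomputable def sumAt (f : wiener) (t : ℂ) : ℂ := ∑' n, coeff n f * t ^ n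

theorem summable_norm_coeff_mul_pow {t : ℂ} (ht : ‖t‖ ≤ 1) (f : wiener) :
    Summable fun n => ‖coeff n f * t ^ n‖ := by
  refine Summable.of_nonneg_of_le (fun _ => norm_nonneg _) (fun n => ?_) (summable_norm f)
  rw [norm_mul, norm_pow]
  exact mul_le_of_le_one_right (norm_nonneg _) (pow_le_one₀ (norm_nonneg _) ht)

/-- Evaluation of the sum of the power series at a point of the closed unit disc, a character of
the Wiener algebra. -/
noncomputable def eval (t : ℂ) (ht : ‖t‖ ≤ 1) : wiener →ₐ[ℂ] ℂ :=
  AlgHom.ofLinearMap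
    { toFun f := sumAt f t
      map_add' f g := by
        simp only [sumAt, map_add, add_mul]
        exact (summable_norm_coeff_mul_pow ht f).of_norm.tsum_add
          (summable_norm_coeff_mul_pow ht g).of_norm
      map_smul' r f := by
        simp [sumAt, mul_assoc, tsum_mul_left] }
    (by
      change ∑' n, coeff n 1 * t ^ n = 1
      rw [tsum_eq_single 0]
      · simp [coeff_one]
      · intro n hn
        simp [coeff_one, hn])
    (fun f g => by
      change ∑' n, coeff n (f * g) * t ^ n = (∑' n, coeff n f * t ^ n) * ∑' n, coeff n g * t ^ n
      rw [tsum_mul_tsum_eq_tsum_sum_antidiagonal_of_summable_norm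
        (summable_norm_coeff_mul_pow ht f) (summable_norm_coeff_mul_pow ht g)]
      congr 1 with n
      rw [coeff_mul, Finset.sum_mul]
      refine Finset.sum_congr rfl fun p hp => ?_
      rw [← Finset.HasAntidiagonal.mem_antidiagonal.1 hp, pow_add]
      ring)

theorem eval_apply (t : ℂ) (ht : ‖t‖ ≤ 1) (f : wiener) : eval t ht f = sumAt f t := rfl

theorem hasSum_sumAt {t : ℂ} (ht : ‖t‖ ≤ 1) (f : wiener) :
    HasSum (fun n => coeff n f * t ^ n) (sumAt f t) :=
  (summable_norm_coeff_mul_pow ht f).of_norm.hasSum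

theorem norm_sumAt_le {t : ℂ} (ht : ‖t‖ ≤ 1) (f : wiener) : ‖sumAt f t‖ ≤ ‖f‖ :=
  AlgHom.norm_apply_le_self (eval t ht) f

/-- The power series of an element of the Wiener algebra, as a function on the disc of radius
`1`. -/
theorem hasFPowerSeriesOnBall (f : wiener) :
    HasFPowerSeriesOnBall (sumAt f)
      (FormalMultilinearSeries.ofScalars ℂ fun n => coeff n f) 0 1 where
  r_le := by
    refine FormalMultilinearSeries.le_radius_of_bound (r := 1) _ ‖f‖ fun n => ?_
    simpa [FormalMultilinearSeries.ofScalars_norm] using norm_coeff_le n f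
  r_pos := one_pos
  hasSum {t} ht := by
    have ht' : ‖t‖ ≤ 1 := by
      have : ‖t‖₊ < 1 := by simpa [enorm_eq_nnnorm] using ht
      exact_mod_cast this.le
    simpa [FormalMultilinearSeries.ofScalars_apply_eq, mul_comm] using
      hasSum_sumAt ht' f

/-- The derivative of the sum of a power series, given through its coefficients. -/
theorem hasDerivAt_sumAt {u v : wiener} (huv : ∀ n, coeff n v = (n + 1) * coeff (n + 1) u) {t : ℂ}
    (ht : ‖t‖ < 1) :
    HasDerivAt (sumAt u) (sumAt v t) t := by
  have hs : Summable fun n : ℕ => (n : ℝ) * ‖coeff n u‖ := by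
    refine (summable_nat_add_iff 1).1 ((summable_norm v).congr fun n => ?_)
    rw [huv, norm_mul]
    norm_cast
  have hd := hasDerivAt_tsum_of_isPreconnected hs (t := Metric.ball (0 : ℂ) 1) (y₀ := 0)
    (g := fun n t => coeff n u * t ^ n) (g' := fun n t => coeff n u * (n * t ^ (n - 1))) (y := t)
    Metric.isOpen_ball (convex_ball 0 1).isPreconnected
    (fun n y _ => (hasDerivAt_pow n y).const_mul _) (fun n y hy => by
      have hy1 : ‖y‖ ≤ 1 := by simpa using (mem_ball_zero_iff.1 hy).le
      rw [norm_mul, norm_mul, norm_pow, Complex.norm_natCast, mul_left_comm]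
      gcongr
      exact mul_le_of_le_one_right (norm_nonneg _) (pow_le_one₀ (norm_nonneg _) hy1))
    (by simp) ((summable_norm_coeff_mul_pow (by simp) u).of_norm) (by simpa using ht)
  refine hd.congr_deriv ?_
  rw [sumAt, tsum_eq_zero_add' (M := ℂ)]
  · simp only [CharP.cast_eq_zero, zero_mul, mul_zero, zero_add, huv, Nat.add_sub_cancel]
    push_cast
    exact tsum_congr fun n => by ring
  · refine (summable_norm_coeff_mul_pow ht.le v).of_norm.congr fun n => ?_
    rw [huv, Nat.add_sub_cancel]
    push_cast
    ring

/-- An element of the Wiener algebra that vanishes on `(0, 1)` is zero. -/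
theorem eq_zero_of_sumAt {f : wiener}
    (h : ∀ t : ℝ, 0 < t → t < 1 → sumAt f t = 0) : f = 0 := by
  have h1 := (hasFPowerSeriesOnBall f).hasFPowerSeriesAt
  have h2 : ∃ᶠ z in 𝓝[≠] (0 : ℂ), sumAt f z = 0 := by
    have ht : Tendsto (fun t : ℝ => (t : ℂ)) (𝓝[>] 0) (𝓝[≠] 0) := by
      refine tendsto_nhdsWithin_iff.2 ⟨?_, ?_⟩
      · exact (Complex.continuous_ofReal.tendsto' 0 0 (by simp)).mono_left nhdsWithin_le_nhds
      · filter_upwards [self_mem_nhdsWithin] with t ht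
        simpa using (Set.mem_Ioi.1 ht).ne'
    refine ht.frequently (Eventually.frequently ?_)
    filter_upwards [Ioo_mem_nhdsGT (zero_lt_one' ℝ)] with t ht
    exact h t ht.1 ht.2
  have h3 := (h1.analyticAt.frequently_zero_iff_eventually_zero).1 h2
  have h4 := (h1.congr h3).eq_zero
  ext n
  rw [map_zero, ← FormalMultilinearSeries.coeff_ofScalars (𝕜 := ℂ) (p := fun n => coeff n f), h4]
  rfl

theorem ext_sumAt {f g : wiener} (h : ∀ t : ℝ, 0 < t → t < 1 → sumAt f t = sumAt g t) :
    f = g := by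
  refine sub_eq_zero.1 (eq_zero_of_sumAt fun t h0 h1 => ?_)
  have ht : ‖(t : ℂ)‖ ≤ 1 := by
    rw [Complex.norm_real, Real.norm_of_nonneg h0.le]
    exact h1.le
  rw [← eval_apply t ht, map_sub, eval_apply, eval_apply, h t h0 h1, sub_self]

theorem continuousOn_sumAt (f : wiener) : ContinuousOn (sumAt f) (Metric.closedBall 0 1) := by
  refine continuousOn_tsum (fun n => by fun_prop) (summable_norm f) fun n t ht => ?_
  rw [norm_mul, norm_pow]
  exact mul_le_of_le_one_right (norm_nonneg _)
    (pow_le_one₀ (norm_nonneg _) (mem_closedBall_zero_iff.1 ht))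

/-- Dilation `u(t) ↦ u(st)` of the variable. -/
noncomputable def dilate (s : ℂ) (hs : ‖s‖ ≤ 1) : wiener →L[ℂ] wiener :=
  multiplier (fun n => s ^ n) 1 fun n => by
    rw [norm_pow]
    exact pow_le_one₀ (norm_nonneg _) hs

@[simp]
theorem coeff_dilate (s : ℂ) (hs : ‖s‖ ≤ 1) (n : ℕ) (f : wiener) :
    coeff n (dilate s hs f) = s ^ n * coeff n f :=
  coeff_multiplier _ _ _ n f

theorem norm_dilate_le (s : ℂ) (hs : ‖s‖ ≤ 1) (f : wiener) : ‖dilate s hs f‖ ≤ ‖f‖ :=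
  (norm_multiplier_apply_le _ 1 _ zero_le_one f).trans_eq (one_mul _)

theorem sumAt_dilate (s : ℂ) (hs : ‖s‖ ≤ 1) (f : wiener) (t : ℂ) :
    sumAt (dilate s hs f) t = sumAt f (s * t) := by
  simp only [sumAt, coeff_dilate, mul_pow]
  exact tsum_congr fun n => by ring

/-- If `w` has the coefficients of `t u'(t)`, then it is `t u'(t)` inside the disc. -/
theorem exists_hasDerivAt_sumAt {u w : wiener} (h : ∀ n, coeff n w = n * coeff n u) {t : ℂ}
    (ht : ‖t‖ < 1) : ∃ D, HasDerivAt (sumAt u) D t ∧ t * D = sumAt w t := by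
  have hv : Summable fun n => ‖coeff (n + 1) w‖ :=
    (summable_nat_add_iff (f := fun n => ‖coeff n w‖) 1).2 (summable_norm w)
  refine ⟨_, hasDerivAt_sumAt (v := ofCoeff _ hv) (fun n => ?_) ht, ?_⟩
  · rw [coeff_ofCoeff, h]
    push_cast
    rfl
  · simp only [sumAt, coeff_ofCoeff]
    rw [(hasSum_sumAt ht.le w).summable.tsum_eq_zero_add, h 0, ← tsum_mul_left]
    simp only [CharP.cast_eq_zero, zero_mul, zero_add]
    exact tsum_congr fun n => by ring

/-- Conversely, the coefficients of `w` are those of `t u'(t)` when `w(t) = t u'(t)` on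
`(0, 1)`. -/
theorem coeff_eq_of_hasDerivAt {u w : wiener}
    (h : ∀ t : ℝ, 0 < t → t < 1 → ∃ D, HasDerivAt (sumAt u) D t ∧ t * D = sumAt w t) (n : ℕ) :
    coeff n w = n * coeff n u := by
  -- `t u'(t)` need not lie in the algebra, but it does after a dilation by `1/2`.
  have hs : ‖(2⁻¹ : ℂ)‖ ≤ 1 := by norm_num
  have hm : ∀ n : ℕ, ‖(n : ℂ) * 2⁻¹ ^ n‖ ≤ 1 := fun n => by
    have : (n : ℝ) ≤ 2 ^ n := by exact_mod_cast Nat.lt_two_pow_self.le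
    rw [norm_mul, norm_pow, norm_inv, Complex.norm_natCast, Complex.norm_two, inv_pow,
      ← div_eq_mul_inv]
    exact div_le_one_of_le₀ this (by positivity)
  have key : multiplier _ 1 hm u = dilate 2⁻¹ hs w := by
    refine ext_sumAt fun t h0 h1 => ?_
    have ht : ‖(t : ℂ)‖ < 1 := by
      rwa [Complex.norm_real, Real.norm_of_nonneg h0.le]
    obtain ⟨D, hD, hD'⟩ := exists_hasDerivAt_sumAt (u := dilate 2⁻¹ hs u)
      (w := multiplier _ 1 hm u) (fun n => by rw [coeff_multiplier, coeff_dilate, mul_assoc]) ht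
    obtain ⟨E, hE, hE'⟩ := h (2⁻¹ * t) (by positivity) (by linarith)
    push_cast at hE hE'
    have h3 : HasDerivAt (sumAt (dilate 2⁻¹ hs u)) (E * 2⁻¹) t := by
      have h4 := HasDerivAt.comp (t : ℂ) hE ((hasDerivAt_id (t : ℂ)).const_mul 2⁻¹)
      rw [mul_one] at h4
      exact h4.congr_of_eventuallyEq (Eventually.of_forall fun z => sumAt_dilate _ _ _ _)
    rw [← hD', sumAt_dilate, ← hE', hD.unique h3]
    ring
  have h5 := congrArg (coeff n) key
  rw [coeff_multiplier, coeff_dilate] at h5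
  have h6 : (2⁻¹ : ℂ) ^ n ≠ 0 := pow_ne_zero _ (by norm_num)
  refine mul_left_cancel₀ h6 ?_
  rw [← h5]
  ring

/-- The variable `t`, as an element of the Wiener algebra. -/
noncomputable def X : wiener :=
  ⟨PowerSeries.X, summable_of_ne_finset_zero (s := {1}) fun n hn => by
    have : n ≠ 1 := by simpa using hn
    simp [PowerSeries.coeff_X, this]⟩

theorem coeff_succ_X_mul (n : ℕ) (f : wiener) : coeff (n + 1) (X * f) = coeff n f :=
  PowerSeries.coeff_succ_X_mul n f.1

/-- The operator `u(t) ↦ ∫_1^t u`. -/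
noncomputable def primitive : wiener →L[ℂ] wiener :=
  let K := (ContinuousLinearMap.mul ℂ wiener X).comp
    (multiplier (fun n => ((n : ℂ) + 1)⁻¹) 1 fun n => by
      rw [norm_inv]
      refine inv_le_one_of_one_le₀ ?_
      norm_cast
      simp)
  K - ((eval 1 (by simp)).toContinuousLinearMap.comp K).smulRight 1

theorem sumAt_primitive_one (f : wiener) : sumAt (primitive f) 1 = 0 := by
  rw [← eval_apply 1 (by simp)]
  simp [primitive]

theorem coeff_succ_primitive (n : ℕ) (f : wiener) :
    (n + 1) * coeff (n + 1) (primitive f) = coeff n f := by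
  have : (n : ℂ) + 1 ≠ 0 := Nat.cast_add_one_ne_zero n
  simp [primitive, coeff_succ_X_mul, coeff_one, mul_inv_cancel_left₀ this]

/-- Solution of the first order equation `z' = u` with the value of `z` prescribed at `1`. -/
theorem eq_algebraMap_add_primitive_iff (z u : wiener) (c : ℂ) :
    z = algebraMap ℂ wiener c + primitive u ↔
      sumAt z 1 = c ∧ ∀ n : ℕ, (n + 1) * coeff (n + 1) z = coeff n u := by
  constructor
  · rintro rfl
    refine ⟨?_, fun n => ?_⟩
    · rw [← eval_apply 1 (by simp), map_add, eval_apply 1 _ (primitive u), sumAt_primitive_one]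
      simp
    · rw [map_add, coeff_algebraMap, if_neg n.succ_ne_zero, zero_add, coeff_succ_primitive]
  · rintro ⟨h1, h2⟩
    have h3 : z - primitive u = algebraMap ℂ wiener (coeff 0 (z - primitive u)) := by
      ext n
      rw [coeff_algebraMap]
      cases n with
      | zero => simp
      | succ n =>
        have : (n : ℂ) + 1 ≠ 0 := Nat.cast_add_one_ne_zero n
        rw [if_neg n.succ_ne_zero, map_sub, sub_eq_zero]
        exact mul_left_cancel₀ this ((h2 n).trans (coeff_succ_primitive n u).symm)
    have h4 := congrArg (eval 1 (by simp)) h3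
    rw [map_sub, eval_apply, eval_apply, h1, sumAt_primitive_one, sub_zero] at h4
    rw [h4, AlgHom.commutes, Algebra.algebraMap_self_apply, ← h3]
    abel

end wiener

/-! ### Action of analytic functions on commutative Banach algebras -/

section Lift

variable {ι : Type*} [Fintype ι] {W : Type*} [NormedCommRing W] [NormedAlgebra ℂ W]

/-- Substitution of elements of a commutative Banach algebra `W` for the complex variables of a
power series: each monomial of `p` in the coordinates is replaced by the corresponding product
in `W`. -/
noncomputable def FormalMultilinearSeries.liftAlgebra [DecidableEq ι]
    (p : FormalMultilinearSeries ℂ (ι → ℂ) ℂ) :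
    FormalMultilinearSeries ℂ (ι → W) W := fun k =>
  ∑ i : Fin k → ι, p k (fun j => Pi.single (i j) 1) •
    (ContinuousMultilinearMap.mkPiAlgebraFin ℂ k W).compContinuousLinearMap
      fun j => ContinuousLinearMap.proj (i j)

/-- Characters turn the substitution in the algebra into the value of the power series. -/
theorem FormalMultilinearSeries.algHom_liftAlgebra [DecidableEq ι]
    (p : FormalMultilinearSeries ℂ (ι → ℂ) ℂ) (χ : W →ₐ[ℂ] ℂ) (k : ℕ) (u : ι → W) :
    χ (p.liftAlgebra k fun _ => u) = p k fun _ i => χ (u i) := by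
  have h : (fun i => χ (u i)) = ∑ i, χ (u i) • (Pi.single i (1 : ℂ) : ι → ℂ) := by
    ext i
    simp [Finset.sum_apply, Pi.single_apply]
  rw [h]
  have h2 := (p k).toMultilinearMap.map_sum
    (fun (_ : Fin k) i => χ (u i) • (Pi.single i (1 : ℂ) : ι → ℂ))
  simp only [ContinuousMultilinearMap.coe_coe] at h2
  rw [h2]
  simp only [liftAlgebra, sum_apply, map_sum]
  refine Finset.sum_congr rfl fun i _ => ?_
  rw [ContinuousMultilinearMap.map_smul_univ, _root_.smul_apply, map_smul,
    ContinuousMultilinearMap.compContinuousLinearMap_apply,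
    ContinuousMultilinearMap.mkPiAlgebraFin_apply, map_list_prod, List.map_ofFn, List.prod_ofFn,
    smul_eq_mul, smul_eq_mul, mul_comm]
  rfl

theorem FormalMultilinearSeries.norm_liftAlgebra_le [DecidableEq ι] [NormOneClass W]
    (p : FormalMultilinearSeries ℂ (ι → ℂ) ℂ) (k : ℕ) :
    ‖(p.liftAlgebra k : ContinuousMultilinearMap ℂ (fun _ : Fin k => ι → W) W)‖ ≤
      (Fintype.card ι : ℝ) ^ k * ‖p k‖ := by
  have h : ∀ i ∈ (Finset.univ : Finset (Fin k → ι)), ‖p k (fun j => Pi.single (i j) 1) •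
    (ContinuousMultilinearMap.mkPiAlgebraFin ℂ k W).compContinuousLinearMap
      fun j => (ContinuousLinearMap.proj (i j) : (ι → W) →L[ℂ] W)‖ ≤ ‖p k‖ := by
    intro i _
    have h1 : ‖p k (fun j => Pi.single (i j) 1)‖ ≤ ‖p k‖ := by
      refine ((p k).le_opNorm _).trans (mul_le_of_le_one_right (norm_nonneg _) ?_)
      exact Finset.prod_le_one (fun _ _ => norm_nonneg _) fun j _ => by
        rw [Pi.norm_single, norm_one]
    have h2 : ‖(ContinuousMultilinearMap.mkPiAlgebraFin ℂ k W).compContinuousLinearMap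
        fun j => (ContinuousLinearMap.proj (i j) : (ι → W) →L[ℂ] W)‖ ≤ 1 := by
      refine (ContinuousMultilinearMap.norm_compContinuousLinearMap_le _ _).trans ?_
      rw [ContinuousMultilinearMap.norm_mkPiAlgebraFin, one_mul]
      refine Finset.prod_le_one (fun _ _ => norm_nonneg _) fun j _ => ?_
      exact ContinuousLinearMap.opNorm_le_bound _ zero_le_one fun u => by
        simpa using norm_le_pi_norm u (i j)
    rw [norm_smul]
    exact mul_le_of_le_one_right (norm_nonneg _) h2 |>.trans h1
  refine (norm_sum_le_of_le _ h).trans_eq ?_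
  simp

theorem FormalMultilinearSeries.radius_liftAlgebra_pos [DecidableEq ι] [NormOneClass W]
    (p : FormalMultilinearSeries ℂ (ι → ℂ) ℂ) (hp : 0 < p.radius) :
    0 < (p.liftAlgebra : FormalMultilinearSeries ℂ (ι → W) W).radius := by
  obtain ⟨r, hr0, hr⟩ := ENNReal.lt_iff_exists_nnreal_btwn.1 hp
  have hr0' : 0 < r := by exact_mod_cast hr0
  obtain ⟨C, hC, h⟩ := p.norm_mul_pow_le_of_lt_radius hr
  set m : NNReal := Fintype.card ι + 1
  have hm : 0 < m := by positivity
  refine lt_of_lt_of_le ?_ (FormalMultilinearSeries.le_radius_of_bound _ C (r := r / m) fun k => ?_)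
  · exact_mod_cast div_pos hr0' hm
  · refine le_trans ?_ (h k)
    calc _ ≤ ((m : ℝ) ^ k * ‖p k‖) * ((r / m : NNReal) : ℝ) ^ k := by
            gcongr
            refine (p.norm_liftAlgebra_le k).trans ?_
            gcongr
            simp [m]
      _ = ‖p k‖ * (r : ℝ) ^ k := by
        have : (m : ℝ) ≠ 0 := by exact_mod_cast hm.ne'
        rw [NNReal.coe_div, div_pow]
        field_simp

variable [CompleteSpace W] [NormOneClass W]

/-- An analytic function of finitely many complex variables acts on tuples of small elements of a
commutative Banach algebra, compatibly with all characters. -/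
theorem AnalyticAt.exists_liftAlgebra {f : (ι → ℂ) → ℂ} (hf : AnalyticAt ℂ f 0) :
    ∃ g : (ι → W) → W, AnalyticAt ℂ g 0 ∧
      ∀ᶠ u in 𝓝 0, ∀ χ : W →ₐ[ℂ] ℂ, χ (g u) = f fun i => χ (u i) := by
  classical
  obtain ⟨p, r, hp⟩ := hf
  have hpos := p.radius_liftAlgebra_pos (W := W) (hp.r_pos.trans_le hp.r_le)
  have hg := p.liftAlgebra (W := W) |>.hasFPowerSeriesOnBall hpos
  refine ⟨_, hg.analyticAt, ?_⟩
  filter_upwards [Metric.eball_mem_nhds 0 hpos, Metric.eball_mem_nhds 0 hp.r_pos] with u hu hu' χ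
  have h1 := (hg.hasSum hu).map χ (map_continuous χ)
  rw [zero_add] at h1
  have hχ : (fun i => χ (u i)) ∈ Metric.eball (0 : ι → ℂ) r := by
    rw [Metric.mem_eball, edist_zero_right] at hu' ⊢
    refine lt_of_le_of_lt ?_ hu'
    rw [← ofReal_norm, ← ofReal_norm]
    refine ENNReal.ofReal_le_ofReal ((pi_norm_le_iff_of_nonneg (norm_nonneg _)).2 fun i => ?_)
    exact (AlgHom.norm_apply_le_self χ _).trans (norm_le_pi_norm u i)
  have h2 := hp.hasSum hχ
  rw [zero_add] at h2
  refine h1.unique (h2.congr_fun fun k => ?_)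
  exact p.algHom_liftAlgebra χ k u

end Lift

/-! ### Characteristics as solutions of an analytic equation in a Banach space -/

section Operator

variable {ν : Type*} [Fintype ν] [DecidableEq ν]

attribute [local instance] Matrix.linftyOpNormedRing Matrix.linftyOpNormedAlgebra in
/-- The inverses `(n - A)⁻¹` are bounded, because the resolvent vanishes at infinity. -/
theorem Matrix.exists_bound_inv_natCast_sub (A : Matrix ν ν ℂ) :
    ∃ C : ℝ, ∀ (n : ℕ) (i k : ν), ‖((n : ℂ) • (1 : Matrix ν ν ℂ) - A)⁻¹ i k‖ ≤ C := by
  have h1 : Tendsto (fun n : ℕ => resolvent A (n : ℂ)) atTop (𝓝 0) := by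
    refine (spectrum.resolvent_tendsto_cobounded (𝕜 := ℂ) A).comp ?_
    exact tendsto_norm_atTop_iff_cobounded.1 (by simpa using tendsto_natCast_atTop_atTop)
  obtain ⟨C, hC⟩ := (h1.norm).bddAbove_range
  refine ⟨C, fun n i k => ?_⟩
  have h2 : ((n : ℂ) • (1 : Matrix ν ν ℂ) - A)⁻¹ = resolvent A (n : ℂ) := by
    rw [Matrix.nonsing_inv_eq_ringInverse, resolvent, Algebra.algebraMap_eq_smul_one]
  have h3 : ∀ T : Matrix ν ν ℂ, ‖T i k‖ ≤ ‖T‖ := fun T => by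
    rw [Matrix.linfty_opNorm_def]
    refine le_trans ?_ (NNReal.coe_le_coe.2 (Finset.le_sup (Finset.mem_univ i)))
    push_cast
    exact Finset.single_le_sum (f := fun k => ‖T i k‖) (fun _ _ => norm_nonneg _)
      (Finset.mem_univ k)
  exact (h3 _).trans (h2 ▸ hC ⟨n, rfl⟩)

/-- The system `t Y' - A Y = f` has a bounded solution operator on the Wiener algebra, provided no
`n ∈ ℕ` is an eigenvalue of `A`. -/
theorem wiener.exists_euler_inverse (A : Matrix ν ν ℂ)
    (hA : ∀ n : ℕ, IsUnit ((n : ℂ) • (1 : Matrix ν ν ℂ) - A)) :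
    ∃ M : ν → ν → wiener →L[ℂ] wiener, ∀ Y f : ν → wiener,
      (∀ i, Y i = ∑ k, M i k (f k)) ↔
        ∀ i n, n * coeff n (Y i) = ∑ k, A i k * coeff n (Y k) + coeff n (f i) := by
  obtain ⟨C, hC⟩ := A.exists_bound_inv_natCast_sub
  refine ⟨fun i k => multiplier (fun n => ((n : ℂ) • (1 : Matrix ν ν ℂ) - A)⁻¹ i k) C
    fun n => hC n i k, fun Y f => ?_⟩
  have h1 : (∀ i, Y i = ∑ k, multiplier (fun n => ((n : ℂ) • (1 : Matrix ν ν ℂ) - A)⁻¹ i k) C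
      (fun n => hC n i k) (f k)) ↔ ∀ n : ℕ, (fun i => coeff n (Y i)) =
        Matrix.mulVec ((n : ℂ) • (1 : Matrix ν ν ℂ) - A)⁻¹ fun i => coeff n (f i) := by
    simp only [wiener.ext_iff, funext_iff, map_sum, coeff_multiplier, Matrix.mulVec, dotProduct]
    exact forall_comm
  have h2 : (∀ i n, n * coeff n (Y i) = ∑ k, A i k * coeff n (Y k) + coeff n (f i)) ↔
      ∀ n : ℕ, Matrix.mulVec ((n : ℂ) • (1 : Matrix ν ν ℂ) - A) (fun i => coeff n (Y i)) =
        fun i => coeff n (f i) := by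
    simp only [funext_iff, Matrix.sub_mulVec, Matrix.smul_mulVec, Matrix.one_mulVec,
      Pi.smul_apply, smul_eq_mul, sub_eq_iff_eq_add']
    exact forall_comm
  rw [h1, h2]
  refine forall_congr' fun n => ?_
  have hdet := (Matrix.isUnit_iff_isUnit_det _).1 (hA n)
  constructor
  · intro h
    rw [h, Matrix.mulVec_mulVec, Matrix.mul_nonsing_inv _ hdet, Matrix.one_mulVec]
  · intro h
    rw [← h, Matrix.mulVec_mulVec, Matrix.nonsing_inv_mul _ hdet, Matrix.one_mulVec]

end Operator

/-- Differentials at `0` of an analytic function and of its action on a Banach algebra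
correspond. -/
theorem algHom_fderiv_lift {ι W : Type*} [Fintype ι] [NormedCommRing W] [NormedAlgebra ℂ W]
    [CompleteSpace W] {f : (ι → ℂ) → ℂ} {g : (ι → W) → W} (hf : DifferentiableAt ℂ f 0)
    (hg : DifferentiableAt ℂ g 0)
    (h : ∀ᶠ u in 𝓝 0, ∀ χ : W →ₐ[ℂ] ℂ, χ (g u) = f fun i => χ (u i)) (χ : W →ₐ[ℂ] ℂ)
    (u : ι → W) : χ (fderiv ℂ g 0 u) = fderiv ℂ f 0 fun i => χ (u i) := by
  let L : (ι → W) →L[ℂ] (ι → ℂ) :=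
    ContinuousLinearMap.pi fun i => χ.toContinuousLinearMap.comp (ContinuousLinearMap.proj i)
  have h1 : HasFDerivAt (fun u => χ (g u)) (χ.toContinuousLinearMap.comp (fderiv ℂ g 0)) 0 :=
    χ.toContinuousLinearMap.hasFDerivAt.comp 0 hg.hasFDerivAt
  have h2 : HasFDerivAt (fun u => f (L u)) ((fderiv ℂ f 0).comp L) 0 := by
    refine HasFDerivAt.comp (g := f) 0 ?_ L.hasFDerivAt
    rw [map_zero]
    exact hf.hasFDerivAt
  have h3 := h1.unique (h2.congr_of_eventuallyEq (h.mono fun u hu => hu χ))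
  exact congrArg (fun T => T u) h3

/-- The value at `0` of the action of a function vanishing at `0`. -/
theorem wiener.lift_zero {ι : Type*} [Fintype ι] {f : (ι → ℂ) → ℂ} {g : (ι → wiener) → wiener}
    (h : ∀ᶠ u in 𝓝 0, ∀ χ : wiener →ₐ[ℂ] ℂ, χ (g u) = f fun i => χ (u i)) (hf : f 0 = 0) :
    g 0 = 0 := by
  refine ext_sumAt fun t h0 h1 => ?_
  have ht : ‖(t : ℂ)‖ ≤ 1 := by
    rw [Complex.norm_real, Real.norm_of_nonneg h0.le]
    exact h1.le
  have h2 := h.self_of_nhds (eval t ht)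
  simp only [Pi.zero_apply, map_zero] at h2
  rw [← eval_apply t ht, ← eval_apply t ht, map_zero, h2]
  exact hf

section System

variable {κ ν : Type*} [Fintype κ] [Fintype ν]

/-- The system of the characteristics, for `(ξ, Y) = (z ∘ inl, z ∘ inr)` in the Wiener algebra:
`ξ' = P(x) b(ξ)`, `ξ(1) = x` and `t Y' = A Y + R(ξ, Y)`, where `B` and `R` are the actions on the
Wiener algebra of the components of the vector field and of the right hand side. The differential
equations are expressed through the coefficients, since the derivative of an element of the algebra
need not belong to it. -/
structure IsCharacteristic (P : (κ → ℂ) → ℂ) (B : κ → (κ → wiener) → wiener) (A : Matrix ν ν ℂ)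
    (R : ν → (κ ⊕ ν → wiener) → wiener) (x : κ → ℂ) (z : κ ⊕ ν → wiener) : Prop where
  sumAt_one : ∀ j, wiener.sumAt (z (.inl j)) 1 = x j
  coeff_inl : ∀ (j : κ) (n : ℕ), (n + 1) * wiener.coeff (n + 1) (z (.inl j)) =
    P x * wiener.coeff n (B j (z ∘ Sum.inl))
  coeff_inr : ∀ (i : ν) (n : ℕ), n * wiener.coeff n (z (.inr i)) =
    ∑ k, A i k * wiener.coeff n (z (.inr k)) + wiener.coeff n (R i z)

/-- The characteristic through `x` exists, is unique among small ones and depends analytically on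
`x`: the linearisation of the system at `0` is triangular with invertible diagonal blocks. -/
theorem exists_analyticAt_characteristic [DecidableEq ν] {P : (κ → ℂ) → ℂ}
    {B : κ → (κ → wiener) → wiener}
    {A : Matrix ν ν ℂ} {R : ν → (κ ⊕ ν → wiener) → wiener}
    (hP : AnalyticAt ℂ P 0) (hP0 : P 0 = 0) (hB : ∀ j, AnalyticAt ℂ (B j) 0)
    (hR : ∀ i, AnalyticAt ℂ (R i) 0) (hR0 : ∀ i, R i 0 = 0)
    (hR' : ∀ i z, z ∘ Sum.inl = 0 → fderiv ℂ (R i) 0 z = 0)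
    (hA : ∀ n : ℕ, IsUnit ((n : ℂ) • (1 : Matrix ν ν ℂ) - A)) :
    ∃ φ : (κ → ℂ) → (κ ⊕ ν → wiener), AnalyticAt ℂ φ 0 ∧ φ 0 = 0 ∧
      ∀ᶠ p : (κ → ℂ) × (κ ⊕ ν → wiener) in 𝓝 0, IsCharacteristic P B A R p.1 p.2 ↔ φ p.1 = p.2 := by
  obtain ⟨M, hM⟩ := wiener.exists_euler_inverse A hA
  let Ψ : (κ → ℂ) × (κ ⊕ ν → wiener) → (κ ⊕ ν → wiener) := fun p => Sum.elim
    (fun j => algebraMap ℂ wiener (p.1 j) + wiener.primitive (P p.1 • B j (p.2 ∘ Sum.inl)))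
    (fun i => ∑ k, M i k (R k p.2))
  have hsol : ∀ p : (κ → ℂ) × (κ ⊕ ν → wiener),
      IsCharacteristic P B A R p.1 p.2 ↔ p.2 = Ψ p := by
    intro p
    have h1 : p.2 = Ψ p ↔ (∀ j, p.2 (.inl j) = algebraMap ℂ wiener (p.1 j) +
        wiener.primitive (P p.1 • B j (p.2 ∘ Sum.inl))) ∧
        ∀ i, p.2 (.inr i) = ∑ k, M i k (R k p.2) := by
      rw [funext_iff, Sum.forall]
      rfl
    rw [h1, hM (fun i => p.2 (.inr i)) fun k => R k p.2]
    simp only [wiener.eq_algebraMap_add_primitive_iff]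
    simp only [map_smul, smul_eq_mul]
    exact ⟨fun h => ⟨fun j => ⟨h.1 j, h.2 j⟩, h.3⟩, fun h => ⟨fun j => (h.1 j).1,
      fun j => (h.1 j).2, h.2⟩⟩
  have hΨ : AnalyticAt ℂ Ψ 0 := by
    rw [analyticAt_pi_iff]
    have hfst : AnalyticAt ℂ (fun p : (κ → ℂ) × (κ ⊕ ν → wiener) => p.1) 0 := analyticAt_fst
    have hsnd : AnalyticAt ℂ (fun p : (κ → ℂ) × (κ ⊕ ν → wiener) => p.2) 0 := analyticAt_snd
    rintro (j | i)
    · have h1 : AnalyticAt ℂ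
          (fun p : (κ → ℂ) × (κ ⊕ ν → wiener) => algebraMap ℂ wiener (p.1 j)) 0 :=
        ((Algebra.linearMap ℂ wiener).toContinuousLinearMap.comp
          ((ContinuousLinearMap.proj j).comp (ContinuousLinearMap.fst ℂ (κ → ℂ)
            (κ ⊕ ν → wiener)))).analyticAt 0
      have h2 : AnalyticAt ℂ (fun p : (κ → ℂ) × (κ ⊕ ν → wiener) => P p.1) 0 :=
        AnalyticAt.fun_comp (g := P) hP hfst
      have h3 : AnalyticAt ℂ
          (fun p : (κ → ℂ) × (κ ⊕ ν → wiener) => (p.2 ∘ Sum.inl : κ → wiener)) 0 :=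
        analyticAt_pi_iff.2 fun j => analyticAt_pi_iff.1 hsnd (Sum.inl j)
      have h4 : AnalyticAt ℂ
          (fun p : (κ → ℂ) × (κ ⊕ ν → wiener) => B j (p.2 ∘ Sum.inl)) 0 :=
        AnalyticAt.fun_comp (g := B j) (hB j) h3
      exact h1.add ((wiener.primitive.analyticAt _).fun_comp (h2.smul h4))
    · refine Finset.analyticAt_fun_sum _ fun k _ => ((M i k).analyticAt _).fun_comp ?_
      exact AnalyticAt.fun_comp (g := R k) (hR k) hsnd
  have hΨ0 : Ψ 0 = 0 := by
    ext (j | i) : 1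
    · simp [Ψ, hP0]
    · simp [Ψ, hR0]
  let N : (κ ⊕ ν → wiener) →L[ℂ] (κ ⊕ ν → wiener) :=
    ContinuousLinearMap.pi (Sum.elim 0 fun i => ∑ k, (M i k).comp (fderiv ℂ (R k) 0))
  have hN : ∀ z, N z ∘ Sum.inl = 0 := fun z => by
    ext j
    simp [N]
  -- `N` maps into the `Y` components and only depends on the `ξ` components, as `∂R/∂Y = 0`.
  have hNN : N.comp N = 0 := by
    ext1 z
    ext (j | i) : 1
    · simp [N]
    · have := fun k => hR' k (N z) (hN z)
      simp only [ContinuousLinearMap.comp_apply, zero_apply, Pi.zero_apply]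
      change (∑ k, (M i k).comp (fderiv ℂ (R k) 0)) (N z) = 0
      simp [sum_apply, this]
  -- The `ξ` components of `Ψ(0, z)` vanish because `P(0) = 0`.
  have hderiv : HasFDerivAt (fun z => Ψ (0, z)) N 0 := by
    rw [hasFDerivAt_pi']
    rintro (j | i)
    · have : (fun z => Ψ (0, z) (Sum.inl j)) = fun _ => 0 := by
        ext1 z
        simp [Ψ, hP0]
      rw [this]
      have h0 : (ContinuousLinearMap.proj (Sum.inl j)).comp N = 0 := by
        ext1 z
        exact congrFun (hN z) j
      rw [h0]
      exact hasFDerivAt_const _ _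
    · exact HasFDerivAt.fun_sum fun k _ =>
        (M i k).hasFDerivAt.comp 0 (hR k).differentiableAt.hasFDerivAt
  let Φ : (κ → ℂ) × (κ ⊕ ν → wiener) → (κ ⊕ ν → wiener) := fun p => p.2 - Ψ p
  have hΦ : ContDiffAt ℂ ω Φ 0 := (analyticAt_snd.sub hΨ).contDiffAt
  have hΦ0 : Φ 0 = 0 := by simp [Φ, hΨ0]
  have hΦ' : fderiv ℂ Φ 0 ∘L .inr ℂ (κ → ℂ) (κ ⊕ ν → wiener) = .id ℂ _ - N := by
    have h1 : HasFDerivAt (fun z => Φ (0, z))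
        (fderiv ℂ Φ 0 ∘L .inr ℂ (κ → ℂ) (κ ⊕ ν → wiener)) 0 :=
      HasFDerivAt.comp (g := Φ) 0 (hΦ.differentiableAt (by simp)).hasFDerivAt
        (ContinuousLinearMap.inr ℂ (κ → ℂ) (κ ⊕ ν → wiener)).hasFDerivAt
    exact h1.unique ((hasFDerivAt_id _).sub hderiv)
  have hinv : (fderiv ℂ Φ 0 ∘L .inr ℂ (κ → ℂ) (κ ⊕ ν → wiener)).IsInvertible := by
    rw [hΦ']
    have hNN' : ∀ z, N (N z) = 0 := fun z => congrArg (fun T => T z) hNN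
    exact ⟨ContinuousLinearEquiv.equivOfInverse (.id ℂ _ - N) (.id ℂ _ + N)
      (fun z => by simp [hNN']) (fun z => by simp [hNN']), rfl⟩
  refine ⟨hΦ.implicitFunction (by simp) hinv, ?_, ?_, ?_⟩
  · exact (hΦ.contDiffAt_implicitFunction (by simp) hinv).analyticAt
  · exact hΦ.implicitFunction_apply_self (by simp) hinv
  · filter_upwards [hΦ.eventually_apply_eq_iff_implicitFunction (by simp) hinv] with p hp
    rw [hsol, ← hp, hΦ0]
    exact sub_eq_zero.symm

end System

/-! ### Solution of the normalised system -/

namespace wiener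

variable {ι : Type*} [Fintype ι]

/-- The curve in `ℂ^ι` parametrised by a tuple of elements of the Wiener algebra. -/
noncomputable def curve {ι : Type*} (u : ι → wiener) (t : ℂ) : ι → ℂ := fun i => sumAt (u i) t

theorem norm_curve_le (u : ι → wiener) {t : ℂ} (ht : ‖t‖ ≤ 1) : ‖curve u t‖ ≤ ‖u‖ :=
  (pi_norm_le_iff_of_nonneg (norm_nonneg _)).2 fun i =>
    (norm_sumAt_le ht _).trans (norm_le_pi_norm u i)

theorem continuousOn_curve {ι : Type*} (u : ι → wiener) :
    ContinuousOn (fun s : ℝ => curve u s) (Set.Icc 0 1) := by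
  refine continuousOn_pi.2 fun i => (continuousOn_sumAt (u i)).comp (by fun_prop) fun s hs => ?_
  rw [mem_closedBall_zero_iff, Complex.norm_real, Real.norm_of_nonneg hs.1]
  exact hs.2

theorem norm_comp_inl_le {κ ν : Type*} [Fintype κ] [Fintype ν] (z : κ ⊕ ν → wiener) :
    ‖z ∘ Sum.inl‖ ≤ ‖z‖ :=
  (pi_norm_le_iff_of_nonneg (norm_nonneg _)).2 fun i => norm_le_pi_norm z (Sum.inl i)

theorem elim_curve {κ ν : Type*} (z : κ ⊕ ν → wiener) (t : ℂ) :
    Sum.elim (curve (z ∘ Sum.inl) t) (curve (z ∘ Sum.inr) t) = curve z t := by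
  ext (j | i) <;> rfl

theorem sumAt_linear_add {κ ν : Type*} [Fintype ν] {A : Matrix ν ν ℂ} {z : κ ⊕ ν → wiener}
    {i : ν} (v : wiener) {t : ℂ} (ht : ‖t‖ ≤ 1) :
    sumAt (∑ k, A i k • z (Sum.inr k) + v) t =
      A.mulVec (curve (z ∘ Sum.inr) t) i + sumAt v t := by
  rw [← eval_apply t ht, map_add, map_sum, eval_apply]
  simp only [map_smul, eval_apply]
  rfl

/-- Dilation of all components. -/
noncomputable def dilatePi (s : ℂ) (hs : ‖s‖ ≤ 1) (u : ι → wiener) : ι → wiener :=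
  fun i => dilate s hs (u i)

theorem norm_dilatePi_le (s : ℂ) (hs : ‖s‖ ≤ 1) (u : ι → wiener) : ‖dilatePi s hs u‖ ≤ ‖u‖ :=
  (pi_norm_le_iff_of_nonneg (norm_nonneg _)).2 fun i =>
    (norm_dilate_le s hs _).trans (norm_le_pi_norm u i)

/-- The action of an analytic function on the Wiener algebra commutes with dilations. -/
theorem lift_dilatePi {f : (ι → ℂ) → ℂ} {g : (ι → wiener) → wiener} {ρ : ℝ}
    (h : ∀ u, ‖u‖ < ρ → ∀ χ : wiener →ₐ[ℂ] ℂ, χ (g u) = f fun i => χ (u i)) (s : ℂ)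
    (hs : ‖s‖ ≤ 1) {u : ι → wiener} (hu : ‖u‖ < ρ) :
    g (dilatePi s hs u) = dilate s hs (g u) := by
  refine ext_sumAt fun t h0 h1 => ?_
  have ht : ‖(t : ℂ)‖ ≤ 1 := by
    rw [Complex.norm_real, Real.norm_of_nonneg h0.le]
    exact h1.le
  have hst : ‖s * t‖ ≤ 1 := by
    rw [norm_mul]
    exact mul_le_one₀ hs (norm_nonneg _) ht
  rw [sumAt_dilate, ← eval_apply t ht, ← eval_apply _ hst, h u hu,
    h _ ((norm_dilatePi_le s hs u).trans_lt hu)]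
  simp only [eval_apply, dilatePi, sumAt_dilate]

/-- Pointwise description of the action of an analytic function on the Wiener algebra. -/
theorem sumAt_lift {f : (ι → ℂ) → ℂ} {g : (ι → wiener) → wiener} {ρ : ℝ}
    (h : ∀ u, ‖u‖ < ρ → ∀ χ : wiener →ₐ[ℂ] ℂ, χ (g u) = f fun i => χ (u i)) {t : ℂ}
    (ht : ‖t‖ ≤ 1) {u : ι → wiener} (hu : ‖u‖ < ρ) : sumAt (g u) t = f (curve u t) := by
  rw [← eval_apply t ht, h u hu]
  rfl

end wiener

theorem AnalyticAt.fderiv_apply {E F : Type*} [NormedAddCommGroup E] [NormedSpace ℂ E]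
    [NormedAddCommGroup F] [NormedSpace ℂ F] [CompleteSpace E] [CompleteSpace F] {f : E → F}
    {v : E → E} {x : E}
    (hf : AnalyticAt ℂ f x) (hv : AnalyticAt ℂ v x) :
    AnalyticAt ℂ (fun x => _root_.fderiv ℂ f x (v x)) x :=
  ((hf.fderiv.contDiffAt (n := ω)).clm_apply hv.contDiffAt).analyticAt

theorem exists_pos_forall_norm_lt {E : Type*} [SeminormedAddCommGroup E] {p : E → Prop}
    (h : ∀ᶠ u in 𝓝 0, p u) : ∃ ρ > 0, ∀ u, ‖u‖ < ρ → p u := by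
  simpa using Metric.eventually_nhds_iff.1 h

namespace IsCharacteristic

open wiener

variable {κ ν : Type*} [Fintype ν] {P : (κ → ℂ) → ℂ} {b : (κ → ℂ) → (κ → ℂ)}
  {B : κ → (κ → wiener) → wiener} {A : Matrix ν ν ℂ} {R : ν → (κ ⊕ ν → wiener) → wiener}
  {x : κ → ℂ} {z : κ ⊕ ν → wiener}

theorem curve_one (h : IsCharacteristic P B A R x z) : curve (z ∘ Sum.inl) 1 = x :=
  funext h.sumAt_one

theorem hasDerivAt_curve (h : IsCharacteristic P B A R x z)
    (hB : ∀ t : ℂ, ‖t‖ ≤ 1 → ∀ j, sumAt (B j (z ∘ Sum.inl)) t = b (curve (z ∘ Sum.inl) t) j)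
    {t : ℂ} (ht : ‖t‖ < 1) :
    HasDerivAt (curve (z ∘ Sum.inl)) (P x • b (curve (z ∘ Sum.inl) t)) t := by
  refine hasDerivAt_pi.2 fun j => ?_
  have h1 := hasDerivAt_sumAt (u := z (Sum.inl j)) (v := P x • B j (z ∘ Sum.inl))
    (fun n => by rw [map_smul, smul_eq_mul, h.coeff_inl]) ht
  refine h1.congr_deriv ?_
  rw [← eval_apply t ht.le, map_smul, eval_apply, hB t ht.le]
  rfl

/-- Along a characteristic, `P` is proportional to the parameter, since it grows at unit rate along
the vector field `b`. -/
theorem apply_curve [Fintype κ] (h : IsCharacteristic P B A R x z)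
    (hB : ∀ t : ℂ, ‖t‖ ≤ 1 → ∀ j, sumAt (B j (z ∘ Sum.inl)) t = b (curve (z ∘ Sum.inl) t) j)
    (hP : ∀ t : ℂ, ‖t‖ ≤ 1 → DifferentiableAt ℂ P (curve (z ∘ Sum.inl) t) ∧
      fderiv ℂ P (curve (z ∘ Sum.inl) t) (b (curve (z ∘ Sum.inl) t)) = 1)
    {s : ℝ} (hs : s ∈ Set.Icc (0 : ℝ) 1) : P (curve (z ∘ Sum.inl) s) = s * P x := by
  have hnorm : ∀ t ∈ Set.Icc (0 : ℝ) 1, ‖(t : ℂ)‖ = t := fun t ht => by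
    rw [Complex.norm_real, Real.norm_of_nonneg ht.1]
  let g : ℝ → ℂ := fun t => P (curve (z ∘ Sum.inl) t) - t * P x
  have hcont : ContinuousOn g (Set.Icc s 1) := by
    refine ContinuousOn.sub (fun t ht => ?_) (by fun_prop)
    have ht' : t ∈ Set.Icc (0 : ℝ) 1 := ⟨hs.1.trans ht.1, ht.2⟩
    have h1 := (hP t ((hnorm t ht').trans_le ht'.2)).1.continuousAt
    exact ContinuousAt.comp_continuousWithinAt (g := P) h1
      ((continuousOn_curve (z ∘ Sum.inl) t ht').mono (Set.Icc_subset_Icc_left hs.1))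
  have hder : ∀ t ∈ Set.Ico s 1, HasDerivWithinAt g 0 (Set.Ici t) t := by
    intro t ht
    have ht' : t ∈ Set.Icc (0 : ℝ) 1 := ⟨hs.1.trans ht.1, ht.2.le⟩
    have ht1 : ‖(t : ℂ)‖ < 1 := (hnorm t ht').trans_lt ht.2
    obtain ⟨h1, h2⟩ := hP t ht1.le
    have h3 := h1.hasFDerivAt.comp_hasDerivAt (t : ℂ) (h.hasDerivAt_curve hB ht1)
    rw [map_smul, h2, smul_eq_mul, mul_one] at h3
    have h4 := (h3.sub ((hasDerivAt_id (t : ℂ)).mul_const (P x))).comp_ofReal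
    rw [one_mul, sub_self] at h4
    exact h4.hasDerivWithinAt
  have h5 := constant_of_has_deriv_right_zero hcont hder 1 ⟨hs.2, le_rfl⟩
  simp only [g, Complex.ofReal_one, one_mul, h.curve_one, sub_self] at h5
  exact sub_eq_zero.1 h5.symm

/-- A dilated characteristic is again a characteristic, through another point of the same
curve. -/
theorem dilate (h : IsCharacteristic P B A R x z) {s : ℂ} (hs : ‖s‖ ≤ 1)
    (hP : P (curve (z ∘ Sum.inl) s) = s * P x)
    (hB : ∀ j, B j (dilatePi s hs (z ∘ Sum.inl)) = wiener.dilate s hs (B j (z ∘ Sum.inl)))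
    (hR : ∀ i, R i (dilatePi s hs z) = wiener.dilate s hs (R i z)) :
    IsCharacteristic P B A R (curve (z ∘ Sum.inl) s) (dilatePi s hs z) where
  sumAt_one j := by
    simp only [dilatePi, sumAt_dilate, mul_one]
    rfl
  coeff_inl j n := by
    have h1 : B j (dilatePi s hs z ∘ Sum.inl) = wiener.dilate s hs (B j (z ∘ Sum.inl)) := hB j
    simp only [h1, dilatePi, coeff_dilate, hP]
    linear_combination s ^ (n + 1) * h.coeff_inl j n
  coeff_inr i n := by
    simp only [hR, dilatePi, coeff_dilate]
    have h1 := h.coeff_inr i n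
    have h2 : ∑ k, A i k * (s ^ n * coeff n (z (Sum.inr k))) =
        s ^ n * ∑ k, A i k * coeff n (z (Sum.inr k)) := by
      rw [Finset.mul_sum]
      exact Finset.sum_congr rfl fun k _ => by ring
    rw [h2]
    linear_combination s ^ n * h1

end IsCharacteristic

section Normalized

open wiener

variable {κ ν : Type*} [Fintype κ] [Fintype ν]

/-- The theorem for a vector field `b` normalised by `b(P) = 1` and a right hand side split into
its linear part in `y` at the origin and a remainder. -/
theorem exists_unique_analytic_solution [DecidableEq ν] {P : (κ → ℂ) → ℂ} {b : (κ → ℂ) → (κ → ℂ)}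
    {A : Matrix ν ν ℂ} {r : ν → (κ ⊕ ν → ℂ) → ℂ}
    (hP : AnalyticAt ℂ P 0) (hP0 : P 0 = 0) (hb : AnalyticAt ℂ b 0)
    (hPb : ∀ᶠ x in 𝓝 0, fderiv ℂ P x (b x) = 1)
    (hr : ∀ i, AnalyticAt ℂ (r i) 0) (hr0 : ∀ i, r i 0 = 0)
    (hr' : ∀ i v, v ∘ Sum.inl = 0 → fderiv ℂ (r i) 0 v = 0)
    (hA : ∀ n : ℕ, IsUnit ((n : ℂ) • (1 : Matrix ν ν ℂ) - A)) :
    ∃ y : (κ → ℂ) → (ν → ℂ), (AnalyticAt ℂ y 0 ∧ y 0 = 0 ∧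
      ∀ᶠ x in 𝓝 0, P x • fderiv ℂ y x (b x) = A.mulVec (y x) + fun i => r i (Sum.elim x (y x))) ∧
      ∀ y' : (κ → ℂ) → (ν → ℂ), (AnalyticAt ℂ y' 0 ∧ y' 0 = 0 ∧
        ∀ᶠ x in 𝓝 0, P x • fderiv ℂ y' x (b x) =
          A.mulVec (y' x) + fun i => r i (Sum.elim x (y' x))) → y' =ᶠ[𝓝 0] y := by
  choose B hB hBl using fun j => (analyticAt_pi_iff.1 hb j).exists_liftAlgebra (W := wiener)
  choose R hR hRl using fun i => (hr i).exists_liftAlgebra (W := wiener)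
  have hR' : ∀ i z, z ∘ Sum.inl = 0 → fderiv ℂ (R i) 0 z = 0 := by
    intro i z hz
    refine ext_sumAt fun t h0 h1 => ?_
    have ht : ‖(t : ℂ)‖ ≤ 1 := by
      rw [Complex.norm_real, Real.norm_of_nonneg h0.le]
      exact h1.le
    rw [← eval_apply t ht, ← eval_apply t ht, map_zero,
      algHom_fderiv_lift (hr i).differentiableAt (hR i).differentiableAt (hRl i)]
    refine hr' i _ (funext fun j => ?_)
    have : z (Sum.inl j) = 0 := congrFun hz j
    simp [this]
  obtain ⟨φ, hφ, hφ0, hchar⟩ := exists_analyticAt_characteristic hP hP0 hB hR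
    (fun i => lift_zero (hRl i) (hr0 i)) hR' hA
  let y : (κ → ℂ) → (ν → ℂ) := fun x => curve (φ x ∘ Sum.inr) 1
  have hy : AnalyticAt ℂ y 0 := analyticAt_pi_iff.2 fun i =>
    ((eval 1 (by simp)).toContinuousLinearMap.analyticAt _).fun_comp
      (analyticAt_pi_iff.1 hφ (Sum.inr i))
  -- A common radius on which all the local properties hold.
  obtain ⟨ρ₁, hρ₁, hBl⟩ := exists_pos_forall_norm_lt (eventually_all.2 hBl)
  obtain ⟨ρ₂, hρ₂, hRl⟩ := exists_pos_forall_norm_lt (eventually_all.2 hRl)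
  obtain ⟨ρ₃, hρ₃, hPl⟩ := exists_pos_forall_norm_lt (hP.eventually_analyticAt.and hPb)
  obtain ⟨ρ₄, hρ₄, hchar⟩ := exists_pos_forall_norm_lt hchar
  have hφlt : ∀ ρ > 0, ∀ᶠ x in 𝓝 0, ‖φ x‖ < ρ := fun ρ hρ => by
    have := hφ.continuousAt.norm.tendsto
    rw [hφ0, norm_zero] at this
    exact this.eventually_lt_const hρ
  have hxlt : ∀ ρ > 0, ∀ᶠ x : κ → ℂ in 𝓝 0, ‖x‖ < ρ := fun ρ hρ => by
    filter_upwards [Metric.ball_mem_nhds (0 : κ → ℂ) hρ] with x hx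
    exact mem_ball_zero_iff.1 hx
  have hgood : ∀ ρ > 0, ∀ᶠ x in 𝓝 0, ‖φ x‖ < ρ ∧ IsCharacteristic P B A R x (φ x) ∧
      (∀ t : ℂ, ‖t‖ ≤ 1 → ∀ j,
        sumAt (B j (φ x ∘ Sum.inl)) t = b (curve (φ x ∘ Sum.inl) t) j) ∧
      (∀ t : ℂ, ‖t‖ ≤ 1 → ∀ i, sumAt (R i (φ x)) t = r i (curve (φ x) t)) ∧
      ∀ s ∈ Set.Icc (0 : ℝ) 1, P (curve (φ x ∘ Sum.inl) s) = s * P x := by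
    intro ρ hρ
    filter_upwards [hφlt ρ hρ, hφlt ρ₁ hρ₁, hφlt ρ₂ hρ₂, hφlt ρ₃ hρ₃, hφlt ρ₄ hρ₄, hxlt ρ₄ hρ₄]
      with x h0 h1 h2 h3 h4 h5
    have hc : IsCharacteristic P B A R x (φ x) :=
      (hchar (x, φ x) (max_lt h5 h4)).2 rfl
    have h6 : ∀ t : ℂ, ‖t‖ ≤ 1 → ∀ j,
        sumAt (B j (φ x ∘ Sum.inl)) t = b (curve (φ x ∘ Sum.inl) t) j := fun t ht j =>
      sumAt_lift (f := fun x => b x j) (fun u hu => hBl u hu j) ht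
        ((norm_comp_inl_le _).trans_lt h1)
    refine ⟨h0, hc, h6, fun t ht i => sumAt_lift (fun u hu => hRl u hu i) ht h2, fun s hs => ?_⟩
    refine hc.apply_curve h6 (fun t ht => ?_) hs
    have h7 := hPl (curve (φ x ∘ Sum.inl) t)
      (((norm_curve_le _ ht).trans (norm_comp_inl_le _)).trans_lt h3)
    exact ⟨h7.1.differentiableAt, h7.2⟩
  have hreal : ∀ t ∈ Set.Icc (0 : ℝ) 1, ‖(t : ℂ)‖ ≤ 1 := fun t ht => by
    rw [Complex.norm_real, Real.norm_of_nonneg ht.1]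
    exact ht.2
  have hlim : ∀ u : κ → wiener,
      Tendsto (fun s : ℝ => curve u s) (𝓝[<] 1) (𝓝 (curve u 1)) := fun u => by
    have h1 := (continuousOn_curve u 1 ⟨zero_le_one, le_rfl⟩).mono_left
      (nhdsWithin_le_of_mem (Icc_mem_nhdsLT zero_lt_one))
    simpa using h1
  have hy0 : y 0 = 0 := by
    ext i
    simp [y, curve, hφ0, sumAt]
  refine ⟨y, ⟨hy, hy0, ?_⟩, ?_⟩
  · -- The value of `y` at the point `s` of a characteristic is the value of `Y` at `s`.
    obtain ⟨ρ₅, hρ₅, hyl⟩ := exists_pos_forall_norm_lt hy.eventually_analyticAt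
    let e : (κ → ℂ) → (ν → ℂ) := fun x =>
      P x • fderiv ℂ y x (b x) - (A.mulVec (y x) + fun i => r i (Sum.elim x (y x)))
    have he : AnalyticAt ℂ e 0 := by
      refine (hP.smul (hy.fderiv_apply hb)).sub (AnalyticAt.add ?_ ?_)
      · exact (A.mulVecLin.toContinuousLinearMap.analyticAt _).fun_comp hy
      · refine analyticAt_pi_iff.2 fun i => ?_
        refine AnalyticAt.fun_comp_of_eq (hr i) (y := 0) (analyticAt_pi_iff.2 ?_) ?_
        · rintro (j | k)
          · exact (ContinuousLinearMap.proj (R := ℂ) (φ := fun _ : κ => ℂ) j).analyticAt 0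
          · exact analyticAt_pi_iff.1 hy k
        · rw [hy0]
          ext (j | k) <;> rfl
    filter_upwards [hgood _ (lt_min hρ₁ (lt_min hρ₂ (lt_min hρ₄ hρ₅))),
      he.eventually_analyticAt] with x hx hex
    obtain ⟨h0, hc, hBx, hRx, hPx⟩ := hx
    simp only [lt_min_iff] at h0
    obtain ⟨h1, h2, h4, h5⟩ := h0
    have hys : ∀ s ∈ Set.Icc (0 : ℝ) 1,
        y (curve (φ x ∘ Sum.inl) s) = curve (φ x ∘ Sum.inr) s := by
      intro s hs
      have hd := hc.dilate (hreal s hs) (hPx s hs)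
        (fun j => lift_dilatePi (f := fun x => b x j) (fun u hu => hBl u hu j) _ _
          ((norm_comp_inl_le _).trans_lt h1))
        (fun i => lift_dilatePi (fun u hu => hRl u hu i) _ _ h2)
      have h6 := (hchar (curve (φ x ∘ Sum.inl) s, dilatePi s (hreal s hs) (φ x))
        (max_lt (((norm_curve_le _ (hreal s hs)).trans (norm_comp_inl_le _)).trans_lt h4)
          ((norm_dilatePi_le _ _ _).trans_lt h4))).1 hd
      ext i
      simp only [y, h6, curve, Function.comp_apply, dilatePi, sumAt_dilate, mul_one]
    have hes : ∀ t ∈ Set.Ioo (0 : ℝ) 1, e (curve (φ x ∘ Sum.inl) t) = 0 := by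
      intro t ht
      have htI : t ∈ Set.Icc (0 : ℝ) 1 := ⟨ht.1.le, ht.2.le⟩
      have ht1 : ‖(t : ℂ)‖ < 1 := by
        rw [Complex.norm_real, Real.norm_of_nonneg ht.1.le]
        exact ht.2
      have hyd := (hyl (curve (φ x ∘ Sum.inl) t) (((norm_curve_le _ ht1.le).trans
        (norm_comp_inl_le _)).trans_lt h5)).differentiableAt
      have h6 := hyd.hasFDerivAt.comp_hasDerivAt (t : ℂ) (hc.hasDerivAt_curve hBx ht1)
      refine sub_eq_zero.2 ?_
      ext i
      obtain ⟨D, hD, hD'⟩ := exists_hasDerivAt_sumAt (u := φ x (Sum.inr i))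
        (w := ∑ k, A i k • φ x (Sum.inr k) + R i (φ x))
        (fun n => by simp [hc.coeff_inr i n]) ht1
      have h7 : HasDerivAt (fun s : ℝ => sumAt (φ x (Sum.inr i)) s)
          (fderiv ℂ y (curve (φ x ∘ Sum.inl) t) (P x • b (curve (φ x ∘ Sum.inl) t)) i) t := by
        refine (hasDerivAt_pi.1 h6 i).comp_ofReal.congr_of_eventuallyEq ?_
        filter_upwards [Ioo_mem_nhds ht.1 ht.2] with s hs
        exact (congrFun (hys s ⟨hs.1.le, hs.2.le⟩) i).symm
      rw [hPx t htI, mul_smul, ← map_smul, Pi.smul_apply, smul_eq_mul,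
        h7.unique hD.comp_ofReal, hD', sumAt_linear_add _ ht1.le, hRx t ht1.le, hys t htI,
        Pi.add_apply, elim_curve]
    -- The point `x` is the end `t = 1` of its characteristic, on the boundary of the disc.
    have h9 : Tendsto (fun s : ℝ => e (curve (φ x ∘ Sum.inl) s)) (𝓝[<] 1) (𝓝 (e x)) := by
      refine hex.continuousAt.tendsto.comp ?_
      simpa [hc.curve_one] using hlim (φ x ∘ Sum.inl)
    have h10 : e x = 0 := by
      refine tendsto_nhds_unique h9 (tendsto_const_nhds.congr' ?_)
      filter_upwards [Ioo_mem_nhdsLT zero_lt_one] with t ht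
      exact (hes t ht).symm
    exact sub_eq_zero.1 h10
  · rintro y' ⟨hy', hy'0, hy'eq⟩
    choose Z hZ hZl using fun i => (analyticAt_pi_iff.1 hy' i).exists_liftAlgebra (W := wiener)
    have hZ0 : ∀ i, Z i 0 = 0 := fun i => lift_zero (f := fun x => y' x i) (hZl i) (congrFun hy'0 i)
    obtain ⟨ρ₅, hρ₅, hyl⟩ := exists_pos_forall_norm_lt (hy'.eventually_analyticAt.and hy'eq)
    obtain ⟨ρ₆, hρ₆, hZl⟩ := exists_pos_forall_norm_lt (eventually_all.2 hZl)
    -- Any solution, composed with the curve through `x`, gives a characteristic through `x`.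
    let ζ : (κ → ℂ) → (κ ⊕ ν → wiener) := fun x =>
      Sum.elim (φ x ∘ Sum.inl) fun i => Z i (φ x ∘ Sum.inl)
    have hζ : ∀ ρ > 0, ∀ᶠ x in 𝓝 0, ‖ζ x‖ < ρ := by
      intro ρ hρ
      have hcont : ContinuousAt ζ 0 := by
        refine continuousAt_pi.2 ?_
        have h1 : ∀ j, ContinuousAt (fun x => φ x (Sum.inl j)) 0 := fun j =>
          continuousAt_pi.1 hφ.continuousAt _
        rintro (j | i)
        · exact h1 j
        · refine ContinuousAt.comp (g := Z i) ?_ (continuousAt_pi.2 h1)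
          have : φ 0 ∘ Sum.inl = 0 := by rw [hφ0]; rfl
          change ContinuousAt (Z i) (φ 0 ∘ Sum.inl)
          rw [this]
          exact (hZ i).continuousAt
      have h0 : ζ 0 = 0 := by
        ext (j | i) : 1
        · simp [ζ, hφ0]
        · have : φ 0 ∘ Sum.inl = 0 := by rw [hφ0]; rfl
          simp [ζ, this, hZ0]
      have h1 := hcont.norm.tendsto
      rw [h0, norm_zero] at h1
      exact h1.eventually_lt_const hρ
    filter_upwards [hgood _ (lt_min hρ₅ hρ₆), hζ _ (lt_min hρ₂ hρ₄), hxlt ρ₄ hρ₄]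
      with x hx hζx hxρ
    obtain ⟨h0, hc, hBx, hRx, hPx⟩ := hx
    simp only [lt_min_iff] at h0 hζx
    have hZs : ∀ t : ℂ, ‖t‖ ≤ 1 → ∀ i,
        sumAt (Z i (φ x ∘ Sum.inl)) t = y' (curve (φ x ∘ Sum.inl) t) i := fun t ht i =>
      sumAt_lift (f := fun x => y' x i) (fun u hu => hZl u hu i) ht
        ((norm_comp_inl_le _).trans_lt h0.2)
    have hcζ : IsCharacteristic P B A R x (ζ x) := by
      refine ⟨hc.sumAt_one, hc.coeff_inl, fun i n => ?_⟩
      -- The third equation holds because `y'` solves the differential equation along the curve.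
      have h1 := coeff_eq_of_hasDerivAt (u := ζ x (Sum.inr i))
        (w := ∑ k, A i k • ζ x (Sum.inr k) + R i (ζ x)) (fun t ht0 ht1 => ?_) n
      · rw [← h1]
        simp
      have ht : ‖(t : ℂ)‖ < 1 := by rwa [Complex.norm_real, Real.norm_of_nonneg ht0.le]
      obtain ⟨hyd, hye⟩ := hyl (curve (φ x ∘ Sum.inl) t) (((norm_curve_le _ ht.le).trans
        (norm_comp_inl_le _)).trans_lt h0.1)
      have h6 := hyd.differentiableAt.hasFDerivAt.comp_hasDerivAt (t : ℂ)
        (hc.hasDerivAt_curve hBx ht)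
      have hcurve : curve (ζ x ∘ Sum.inr) t = y' (curve (φ x ∘ Sum.inl) t) :=
        funext fun i => hZs t ht.le i
      refine ⟨_, (hasDerivAt_pi.1 h6 i).congr_of_eventuallyEq ?_, ?_⟩
      · filter_upwards [Metric.isOpen_ball.mem_nhds (mem_ball_zero_iff.2 ht)] with s hs
        exact hZs s (mem_ball_zero_iff.1 hs).le i
      · rw [sumAt_linear_add _ ht.le, sumAt_lift (fun u hu => hRl u hu i) ht.le hζx.1, hcurve,
          ← smul_eq_mul, ← Pi.smul_apply, map_smul, smul_smul, ← hPx t ⟨ht0.le, ht1.le⟩, hye,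
          ← hcurve, Pi.add_apply]
        exact congrArg (fun v => A.mulVec (curve (ζ x ∘ Sum.inr) t) i + r i v)
          (elim_curve (ζ x) t)
    have h3 : φ x = ζ x := (hchar (x, ζ x) (max_lt hxρ hζx.2)).1 hcζ
    ext i
    have h4 := hZs 1 (by simp) i
    rw [hc.curve_one] at h4
    rw [← h4]
    simp only [y]
    rw [h3]
    rfl

end Normalized

/-! ### Reduction to the normalised system -/

theorem diffOp_eq_fderiv {d : ℕ} {E : Type*} [NormedAddCommGroup E] [NormedSpace ℂ E]
    (a : Fin d → (Fin d → ℂ) → ℂ) (f : (Fin d → ℂ) → E) (x : Fin d → ℂ) :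
    diffOp a f x = fderiv ℂ f x fun j => a j x := by
  rw [pi_eq_sum_univ' fun j => a j x, map_sum]
  simp only [map_smul]
  rfl

theorem theorem2 (d N : ℕ) (P : (Fin d → ℂ) → ℂ) (a : Fin d → (Fin d → ℂ) → ℂ)
    (F : (Fin d → ℂ) → (Fin N → ℂ) → (Fin N → ℂ))
    (hP : AnalyticAt ℂ P 0) (hP0 : P 0 = 0)
    (ha : ∀ j, AnalyticAt ℂ (a j) 0)
    (hF : AnalyticAt ℂ (fun p : (Fin d → ℂ) × (Fin N → ℂ) => F p.1 p.2) (0, 0))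
    (hF0 : F 0 0 = 0)
    (hLP : diffOp a P 0 ≠ 0)
    (hμ : ∀ n : ℕ, IsUnit (jacobianAtZero F -
      ((n : ℂ) * diffOp a P 0) • (1 : Matrix (Fin N) (Fin N) ℂ))) :
    ∃ y : (Fin d → ℂ) → (Fin N → ℂ), IsAnalyticSolution P a F y ∧
      ∀ z : (Fin d → ℂ) → (Fin N → ℂ), IsAnalyticSolution P a F z → z =ᶠ[𝓝 0] y := by
  set c : ℂ := diffOp a P 0
  have ha' : AnalyticAt ℂ (fun x j => a j x) 0 := analyticAt_pi_iff.2 ha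
  have hL : AnalyticAt ℂ (diffOp a P) 0 := by
    have : diffOp a P = fun x => fderiv ℂ P x fun j => a j x := funext (diffOp_eq_fderiv a P)
    rw [this]
    exact hP.fderiv_apply ha'
  have hL0 : ∀ᶠ x in 𝓝 0, diffOp a P x ≠ 0 := hL.continuousAt.eventually_ne hLP
  -- Dividing by `L(P)` normalises the vector field and the right hand side.
  let b : (Fin d → ℂ) → (Fin d → ℂ) := fun x => (diffOp a P x)⁻¹ • fun j => a j x
  let A : Matrix (Fin N) (Fin N) ℂ := c⁻¹ • jacobianAtZero F
  let r : Fin N → (Fin d ⊕ Fin N → ℂ) → ℂ := fun i v =>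
    (diffOp a P (v ∘ Sum.inl))⁻¹ * F (v ∘ Sum.inl) (v ∘ Sum.inr) i - A.mulVec (v ∘ Sum.inr) i
  have hr : ∀ i, AnalyticAt ℂ (r i) 0 := by
    intro i
    let pl : (Fin d ⊕ Fin N → ℂ) →L[ℂ] (Fin d → ℂ) :=
      ContinuousLinearMap.pi fun j => ContinuousLinearMap.proj (Sum.inl j)
    let pr : (Fin d ⊕ Fin N → ℂ) →L[ℂ] (Fin N → ℂ) :=
      ContinuousLinearMap.pi fun k => ContinuousLinearMap.proj (Sum.inr k)
    have h1 : AnalyticAt ℂ (fun v => diffOp a P (pl v)) 0 :=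
      AnalyticAt.fun_comp_of_eq hL (pl.analyticAt 0) (map_zero _)
    have h2 : AnalyticAt ℂ (fun v => F (pl v) (pr v)) 0 :=
      AnalyticAt.fun_comp_of_eq hF ((pl.analyticAt 0).prod (pr.analyticAt 0)) (by simp)
    have h3 : AnalyticAt ℂ (fun v => A.mulVec (pr v)) 0 :=
      (A.mulVecLin.toContinuousLinearMap.analyticAt _).fun_comp (pr.analyticAt 0)
    exact ((h1.inv (by simpa using hLP)).mul (analyticAt_pi_iff.1 h2 i)).sub
      (analyticAt_pi_iff.1 h3 i)
  have hr' : ∀ i v, v ∘ Sum.inl = 0 → fderiv ℂ (r i) 0 v = 0 := by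
    intro i v hv
    let E : (Fin N → ℂ) →L[ℂ] (Fin d ⊕ Fin N → ℂ) :=
      ContinuousLinearMap.pi (Sum.elim 0 fun k => ContinuousLinearMap.proj k)
    have hE : E (v ∘ Sum.inr) = v := by
      ext (j | k)
      · exact (congrFun hv j).symm
      · rfl
    have h1 : HasFDerivAt (fun w => r i (E w)) ((fderiv ℂ (r i) 0).comp E) 0 := by
      refine HasFDerivAt.comp (g := r i) 0 ?_ E.hasFDerivAt
      rw [map_zero]
      exact (hr i).differentiableAt.hasFDerivAt
    have hF1 : HasFDerivAt (F 0) (fderiv ℂ (F 0) 0) 0 := by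
      refine DifferentiableAt.hasFDerivAt (AnalyticAt.differentiableAt ?_)
      exact AnalyticAt.fun_comp_of_eq (f := fun w : Fin N → ℂ => ((0 : Fin d → ℂ), w)) hF
        (analyticAt_const.prod analyticAt_id) rfl
    have h2 : HasFDerivAt (fun w => r i (E w)) (c⁻¹ • (ContinuousLinearMap.proj i).comp
        (fderiv ℂ (F 0) 0) - (ContinuousLinearMap.proj i).comp
          A.mulVecLin.toContinuousLinearMap) 0 :=
      ((hasFDerivAt_pi'.1 hF1 i).const_mul c⁻¹).sub
        (hasFDerivAt_pi'.1 A.mulVecLin.toContinuousLinearMap.hasFDerivAt i)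
    have h3 := congrArg (fun T => T (v ∘ Sum.inr)) (h1.unique h2)
    simp only [ContinuousLinearMap.comp_apply, hE] at h3
    rw [h3]
    have h4 : fderiv ℂ (F 0) 0 (v ∘ Sum.inr) i =
        (jacobianAtZero F).mulVec (v ∘ Sum.inr) i := by
      conv_lhs => rw [pi_eq_sum_univ' (v ∘ Sum.inr), map_sum, Finset.sum_apply]
      refine Finset.sum_congr rfl fun k _ => ?_
      rw [map_smul, Pi.smul_apply, smul_eq_mul, mul_comm]
      rfl
    simp [A, h4]
  have hPb : ∀ᶠ x in 𝓝 0, fderiv ℂ P x (b x) = 1 := by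
    filter_upwards [hL0] with x hx
    rw [map_smul, ← diffOp_eq_fderiv, smul_eq_mul, inv_mul_cancel₀ hx]
  have hA : ∀ n : ℕ, IsUnit ((n : ℂ) • (1 : Matrix (Fin N) (Fin N) ℂ) - A) := by
    intro n
    have h1 : (n : ℂ) • (1 : Matrix (Fin N) (Fin N) ℂ) - A =
        Units.mk0 (-c⁻¹) (neg_ne_zero.2 (inv_ne_zero hLP)) •
          (jacobianAtZero F - ((n : ℂ) * c) • (1 : Matrix (Fin N) (Fin N) ℂ)) := by
      rw [Units.smul_def, Units.val_mk0, smul_sub, smul_smul, neg_smul,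
        show -c⁻¹ * ((n : ℂ) * c) = -n by field_simp, neg_smul]
      abel
    rw [h1, isUnit_smul_iff]
    exact hμ n
  have hsol : ∀ y : (Fin d → ℂ) → (Fin N → ℂ), IsAnalyticSolution P a F y ↔
      (AnalyticAt ℂ y 0 ∧ y 0 = 0 ∧ ∀ᶠ x in 𝓝 0,
        P x • fderiv ℂ y x (b x) = A.mulVec (y x) + fun i => r i (Sum.elim x (y x))) := by
    intro y
    refine and_congr_right fun _ => and_congr_right fun _ => eventually_congr ?_
    filter_upwards [hL0] with x hx
    have h1 : (A.mulVec (y x) + fun i => r i (Sum.elim x (y x))) =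
        (diffOp a P x)⁻¹ • F x (y x) := by
      ext i
      simp only [r, Sum.elim_comp_inl, Sum.elim_comp_inr, Pi.add_apply, Pi.smul_apply,
        smul_eq_mul]
      ring
    rw [h1, map_smul, smul_comm, ← diffOp_eq_fderiv]
    exact (smul_right_injective _ (inv_ne_zero hx)).eq_iff.symm
  have hr0 : ∀ i, r i 0 = 0 := by
    intro i
    have h1 : ((0 : Fin d ⊕ Fin N → ℂ) ∘ Sum.inl) = 0 := rfl
    have h2 : ((0 : Fin d ⊕ Fin N → ℂ) ∘ Sum.inr) = 0 := rfl
    simp [r, h1, h2, hF0]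
  have hb : AnalyticAt ℂ b 0 := (hL.inv hLP).smul ha'
  obtain ⟨y, hy, huniq⟩ := exists_unique_analytic_solution hP hP0 hb hPb hr hr0 hr' hA
  exact ⟨y, (hsol y).2 hy, fun z hz => huniq z ((hsol z).1 hz)⟩
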